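/- Let $\Lambda_{\mathbb R}$ be the algebra of symmetric functions with real coefficients (the symmetric formal power series of bounded degree in countably many variables), let $h_n$ ($n\ge 0$) be the complete homogeneous symmetric functions, and set $h_k=0$ for $k<0$. For partitions $\lambda=(\lambda_1\ge\dots\ge\lambda_\ell\ge 0)$ and $\mu=(\mu_1\ge\dots\ge\mu_\ell\ge 0)$ written with the same number $\ell\ge 0$ of parts and satisfying $\mu_i\le\lambda_i$ for all $i$, let the skew Schur function be $$s_{\lambda/\mu}=\det\bigl(h_{\lambda_i-\mu_j-i+j}\bigr)_{i,j=1}^{\ell}\in\Lambda_{\mathbb R},$$ and let the Schur function be $s_\lambda=s_{\lambda/\mu}$ with $\mu=(0,\dots,0)$. Theorem. Let $t>0$ be a real number and let $\varphi\colon\Lambda_{\mathbb R}\to\mathbb R$ be the homomorphism of real algebras with $$\varphi(h_n)=\frac{1}{(t)_n\,n!}\qquad (n\ge 0),\qquad (t)_n=t(t+1)\cdots(t+n-1).$$ Then $\varphi(s_{\lambda/\mu})>0$ for every skew Schur function $s_{\lambda/\mu}$. In particular, $\varphi(s_\lambda)>0$ for every Schur function $s_\lambda$ (Lassalle's conjecture).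 -/

import Mathlib

noncomputable section

/-- The algebra `Λ_ℝ` of symmetric functions with real coefficients: the formal power series in
countably many variables `x₀, x₁, x₂, …` that have bounded degree and whose coefficients are
unchanged under every permutation of the variables. -/
def SymmFun : Subalgebra ℝ (MvPowerSeries ℕ ℝ) where
  carrier := {f | (∃ d : ℕ, ∀ m : ℕ →₀ ℕ, d < m.degree → MvPowerSeries.coeff m f = 0) ∧
    ∀ (σ : Equiv.Perm ℕ) (m : ℕ →₀ ℕ),
      MvPowerSeries.coeff (m.equivMapDomain σ) f = MvPowerSeries.coeff m f}
  mul_mem' := by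
    rintro f g ⟨⟨d, hd⟩, hf⟩ ⟨⟨e, he⟩, hg⟩
    refine ⟨⟨d + e, fun m hm => ?_⟩, fun σ m => ?_⟩
    · rw [MvPowerSeries.coeff_mul]
      refine Finset.sum_eq_zero fun p hp => ?_
      rw [Finset.HasAntidiagonal.mem_antidiagonal] at hp
      rw [← hp, map_add] at hm
      rcases lt_or_ge d p.1.degree with h | h
      · rw [hd _ h, zero_mul]
      · rw [he p.2 (by omega), mul_zero]
    · rw [MvPowerSeries.coeff_mul, MvPowerSeries.coeff_mul]
      have key : ∀ (τ : Equiv.Perm ℕ) (a b : ℕ →₀ ℕ),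
          (a + b).equivMapDomain τ = a.equivMapDomain τ + b.equivMapDomain τ := by
        intro τ a b
        ext i
        simp
      have inv : ∀ (a : ℕ →₀ ℕ), (a.equivMapDomain σ.symm).equivMapDomain σ = a := by
        intro a
        ext i
        simp
      have inv' : ∀ (a : ℕ →₀ ℕ), (a.equivMapDomain σ).equivMapDomain σ.symm = a := by
        intro a
        ext i
        simp
      symm
      refine Finset.sum_bij' (fun p _ => (p.1.equivMapDomain σ, p.2.equivMapDomain σ))
        (fun p _ => (p.1.equivMapDomain σ.symm, p.2.equivMapDomain σ.symm)) ?_ ?_ ?_ ?_ ?_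
      · intro p hp
        rw [Finset.HasAntidiagonal.mem_antidiagonal] at hp ⊢
        rw [← key, hp]
      · intro p hp
        rw [Finset.HasAntidiagonal.mem_antidiagonal] at hp ⊢
        rw [← key, hp, inv']
      · intro p _
        simp only [inv']
      · intro p _
        simp only [inv]
      · intro p _
        simp only [hf, hg]
  add_mem' := by
    rintro f g ⟨⟨d, hd⟩, hf⟩ ⟨⟨e, he⟩, hg⟩
    refine ⟨⟨max d e, fun m hm => ?_⟩, fun σ m => ?_⟩
    · rw [map_add, hd m (lt_of_le_of_lt (le_max_left _ _) hm),
        he m (lt_of_le_of_lt (le_max_right _ _) hm), add_zero]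
    · rw [map_add, map_add, hf, hg]
  algebraMap_mem' := by
    classical
    intro r
    rw [MvPowerSeries.algebraMap_apply]
    refine ⟨⟨0, fun m hm => ?_⟩, fun σ m => ?_⟩
    · have hm' : m ≠ 0 := by
        rintro rfl
        simp at hm
      rw [MvPowerSeries.coeff_C, if_neg hm']
    · have h : m.equivMapDomain σ = 0 ↔ m = 0 := by
        constructor
        · intro h
          ext i
          have := DFunLike.congr_fun h (σ i)
          simpa using this
        · rintro rfl
          ext i
          simp
      simp only [MvPowerSeries.coeff_C, h]

/-- The complete homogeneous symmetric function `h_n`: the sum of all monomials of degree `n`. -/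
def completeSymm (n : ℕ) : SymmFun :=
  ⟨fun m => if m.degree = n then 1 else 0, by
    refine ⟨⟨n, fun m hm => ?_⟩, fun σ m => ?_⟩
    · exact if_neg (by omega)
    · have h : (m.equivMapDomain σ).degree = m.degree := by
        rw [← Finsupp.degree_mapDomain σ m, Finsupp.equivMapDomain_eq_mapDomain]
      change (if (m.equivMapDomain σ).degree = n then (1 : ℝ) else 0) = if m.degree = n then 1 else 0
      rw [h]⟩

/-- `h_k` for an integer index `k`, with `h_k = 0` for `k < 0`. -/
def completeSymmInt (k : ℤ) : SymmFun :=
  if 0 ≤ k then completeSymm k.toNat else 0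

/-- The skew Schur function `s_{λ/μ} = det (h_{λ_i - μ_j - i + j})`, for sequences `λ, μ` of the same
length `ℓ`. -/
def skewSchur {ℓ : ℕ} (lam mu : Fin ℓ → ℕ) : SymmFun :=
  Matrix.det (Matrix.of fun i j : Fin ℓ =>
    completeSymmInt ((lam i : ℤ) - (mu j : ℤ) - (i : ℤ) + (j : ℤ)))

/-- The Schur function `s_λ`, which is `s_{λ/μ}` with `μ` the empty partition. -/
def schur {ℓ : ℕ} (lam : Fin ℓ → ℕ) : SymmFun :=
  skewSchur lam 0

end

/-! By the determinant formula, the claim is that certain minors of the Toeplitz matrix of `1 /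
((t)_n n!)` are positive. Interlacing the Toeplitz rows for `t` and `t + 1` turns the contiguous
relation of `₀F₁` into one rule: row `m` at `t` is a nonnegative combination of rows `m` and `m - 1`
at `t + 1` (`besselRow_eq`). So a minor at `t` is a nonnegative combination of minors at `t + 1`
(`besselMinor_expand`).

As `t → ∞` the coefficients tend to those of the constant series `1`, whose minors are `0` or `1`,
while the total weight of all steps stays below `exp (ℓ / t)`. Hence all minors are nonnegative
(`besselMinor_nonneg`). Each minor then dominates every single term of its expansion, and a chain of
terms of positive weight leads down to a unitriangular minor, which gives strict positivity
(`besselMinor_two_mul_pos`). -/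

/-- The numbers `1 / ((t)_n n!)`, extended by zero to negative indices. -/
noncomputable def besselCoeff (t : ℝ) (n : ℤ) : ℝ :=
  if 0 ≤ n then 1 / ((ascPochhammer ℝ n.toNat).eval t * (n.toNat.factorial : ℝ)) else 0

/-- The rows of the Hurwitz-type matrix interlacing the Toeplitz matrices of `besselCoeff t` (even
rows) and `besselCoeff (t + 1)` (odd rows), with columns selected by `y`. -/
noncomputable def besselRow {ℓ : ℕ} (y : Fin ℓ → ℤ) (t : ℝ) (m : ℤ) : Fin ℓ → ℝ :=
  fun s => besselCoeff (if Even m then t else t + 1) (m / 2 - y s)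

/-- The minor of the Hurwitz-type matrix with rows `I` and columns `y`. -/
noncomputable def besselMinor {ℓ : ℕ} (y : Fin ℓ → ℤ) (t : ℝ) (I : Fin ℓ → ℤ) : ℝ :=
  Matrix.det (Matrix.of fun r => besselRow y t (I r))

/-- The weight with which a row contributes to the same row at the next parameter. -/
noncomputable def stayWeight (m : ℤ) : ℝ := if Even m then 1 else 0

/-- The weight with which the preceding row at the next parameter contributes to a row. -/
noncomputable def moveWeight (t : ℝ) (m : ℤ) : ℝ := if Even m then 1 / (t * (t + 1)) else 1

/-! ### Contiguous relation and expansion of minors -/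

theorem besselCoeff_of_neg (t : ℝ) {n : ℤ} (hn : n < 0) : besselCoeff t n = 0 :=
  if_neg (by omega)

theorem besselCoeff_zero (t : ℝ) : besselCoeff t 0 = 1 := by
  simp [besselCoeff]

theorem besselCoeff_natCast (t : ℝ) (n : ℕ) :
    besselCoeff t n = 1 / ((ascPochhammer ℝ n).eval t * (n.factorial : ℝ)) := by
  simp [besselCoeff]

theorem ascPochhammer_eval_succ_left (t : ℝ) (n : ℕ) :
    (ascPochhammer ℝ (n + 1)).eval t = t * (ascPochhammer ℝ n).eval (t + 1) := by
  simp [ascPochhammer_succ_left]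

/-- The contiguous relation between the functions `₀F₁(; t; x)`, `₀F₁(; t + 1; x)` and
`₀F₁(; t + 2; x)`, coefficientwise. -/
theorem besselCoeff_contiguous {t : ℝ} (ht : 0 < t) (n : ℤ) :
    besselCoeff t n =
      besselCoeff (t + 1) n + 1 / (t * (t + 1)) * besselCoeff (t + 1 + 1) (n - 1) := by
  rcases lt_trichotomy n 0 with hn | rfl | hn
  · simp [besselCoeff_of_neg _ hn, besselCoeff_of_neg _ (show n - 1 < 0 by omega)]
  · simp [besselCoeff_zero, besselCoeff_of_neg _ (show (-1 : ℤ) < 0 by omega)]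
  · obtain ⟨k, rfl⟩ : ∃ k : ℕ, n = ((k + 1 : ℕ) : ℤ) := ⟨(n - 1).toNat, by omega⟩
    have hk : ((k + 1 : ℕ) : ℤ) - 1 = (k : ℤ) := by push_cast; ring
    rw [hk, besselCoeff_natCast, besselCoeff_natCast, besselCoeff_natCast,
      ascPochhammer_eval_succ_left t, ascPochhammer_succ_eval k (t + 1), Nat.factorial_succ]
    have h := ascPochhammer_eval_succ_left (t + 1) k
    rw [ascPochhammer_succ_eval] at h
    have hP : 0 < (ascPochhammer ℝ k).eval (t + 1) := ascPochhammer_pos k _ (by positivity)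
    have hQ : 0 < (ascPochhammer ℝ k).eval (t + 1 + 1) := ascPochhammer_pos k _ (by positivity)
    have hf : (0 : ℝ) < (k.factorial : ℝ) := by positivity
    have hQ' : (ascPochhammer ℝ k).eval (t + 1 + 1)
        = (ascPochhammer ℝ k).eval (t + 1) * (t + 1 + k) / (t + 1) := by
      field_simp
      linarith
    rw [hQ']
    generalize (ascPochhammer ℝ k).eval (t + 1) = P at *
    have : 0 < t + 1 + k := by positivity
    push_cast
    field_simp
    ring

/-- Even rows are the contiguous relation. An odd row at `t` already has parameter `t + 1`, so it
equals the even row just above it at the next parameter. -/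
theorem besselRow_eq {ℓ : ℕ} (y : Fin ℓ → ℤ) {t : ℝ} (ht : 0 < t) (m : ℤ) :
    besselRow y t m =
      stayWeight m • besselRow y (t + 1) m + moveWeight t m • besselRow y (t + 1) (m - 1) := by
  funext s
  by_cases hm : Even m
  · have h1 : ¬ Even (m - 1) := by grind
    have h2 : (m - 1) / 2 - y s = m / 2 - y s - 1 := by grind
    simp only [besselRow, stayWeight, moveWeight, hm, h1, h2, if_true, if_false, Pi.add_apply,
      Pi.smul_apply, smul_eq_mul, one_mul]
    exact besselCoeff_contiguous ht _
  · have h1 : Even (m - 1) := by grind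
    have h2 : (m - 1) / 2 = m / 2 := by grind
    simp [besselRow, stayWeight, moveWeight, hm, h1, h2]

theorem besselMinor_expand {ℓ : ℕ} (y : Fin ℓ → ℤ) {t : ℝ} (ht : 0 < t) (I : Fin ℓ → ℤ) :
    besselMinor y t I = ∑ s : Finset (Fin ℓ),
      (∏ r, if r ∈ s then stayWeight (I r) else moveWeight t (I r)) *
        besselMinor y (t + 1) (fun r => if r ∈ s then I r else I r - 1) := by
  have h := (Matrix.detRowAlternating (n := Fin ℓ) (R := ℝ)).toMultilinearMap.map_add_univ
    (fun r => stayWeight (I r) • besselRow y (t + 1) (I r))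
    (fun r => moveWeight t (I r) • besselRow y (t + 1) (I r - 1))
  have h0 : besselMinor y t I = (Matrix.detRowAlternating (n := Fin ℓ) (R := ℝ)).toMultilinearMap
      ((fun r => stayWeight (I r) • besselRow y (t + 1) (I r)) +
        (fun r => moveWeight t (I r) • besselRow y (t + 1) (I r - 1))) := by
    change Matrix.detRowAlternating _ = Matrix.detRowAlternating _
    congr 1
    funext r
    exact besselRow_eq y ht (I r)
  rw [h0, h]
  refine Finset.sum_congr rfl fun s _ => ?_
  have h1 : s.piecewise (fun r => stayWeight (I r) • besselRow y (t + 1) (I r))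
      (fun r => moveWeight t (I r) • besselRow y (t + 1) (I r - 1)) =
      fun r => (if r ∈ s then stayWeight (I r) else moveWeight t (I r)) •
        besselRow y (t + 1) (if r ∈ s then I r else I r - 1) := by
    funext r
    by_cases hr : r ∈ s <;> simp [hr]
  rw [h1, MultilinearMap.map_smul_univ]
  rfl

/-! ### Weights and lower bounds uniform in the number of steps -/

theorem stayWeight_nonneg (m : ℤ) : 0 ≤ stayWeight m := by
  unfold stayWeight
  split_ifs <;> norm_num

theorem moveWeight_nonneg {t : ℝ} (ht : 0 < t) (m : ℤ) : 0 ≤ moveWeight t m := by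
  unfold moveWeight
  split_ifs <;> positivity

theorem prod_weight_nonneg {ℓ : ℕ} {t : ℝ} (ht : 0 < t) (I : Fin ℓ → ℤ) (s : Finset (Fin ℓ)) :
    0 ≤ ∏ r, if r ∈ s then stayWeight (I r) else moveWeight t (I r) :=
  Finset.prod_nonneg fun r _ => by
    split_ifs
    exacts [stayWeight_nonneg _, moveWeight_nonneg ht _]

/-- The sum factors over the rows, each factor being at most `1 + 1 / (t * (t + 1))`. Writing the
exponent as a difference makes the bounds of successive steps telescope. -/
theorem sum_prod_weight_le {ℓ : ℕ} {t : ℝ} (ht : 0 < t) (I : Fin ℓ → ℤ) :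
    ∑ s : Finset (Fin ℓ), (∏ r, if r ∈ s then stayWeight (I r) else moveWeight t (I r)) ≤
      Real.exp (ℓ * (1 / t - 1 / (t + 1))) := by
  have h1 : ∑ s : Finset (Fin ℓ), (∏ r, if r ∈ s then stayWeight (I r) else moveWeight t (I r)) =
      ∏ r, (stayWeight (I r) + moveWeight t (I r)) := by
    rw [Fintype.prod_add]
    refine Finset.sum_congr rfl fun s _ => ?_
    rw [Finset.prod_ite]
    congr 1
    · exact Finset.prod_congr (by ext; simp) fun _ _ => rfl
    · exact Finset.prod_congr (by ext; simp) fun _ _ => rfl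
  have h2 : 1 / t - 1 / (t + 1) = 1 / (t * (t + 1)) := by
    field_simp
    ring
  rw [h1, Real.exp_nat_mul]
  calc ∏ r, (stayWeight (I r) + moveWeight t (I r))
      ≤ ∏ _r : Fin ℓ, Real.exp (1 / t - 1 / (t + 1)) := by
        refine Finset.prod_le_prod
          (fun r _ => add_nonneg (stayWeight_nonneg _) (moveWeight_nonneg ht _)) fun r _ => ?_
        have h3 := Real.add_one_le_exp (1 / t - 1 / (t + 1))
        have h4 : 0 < 1 / (t * (t + 1)) := by positivity
        refine le_trans ?_ h3
        rw [h2]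
        unfold stayWeight moveWeight
        split_ifs <;> linarith
    _ = _ := by simp

theorem besselMinor_eq_zero_of_not_injective {ℓ : ℕ} (y : Fin ℓ → ℤ) (t : ℝ) {I : Fin ℓ → ℤ}
    (hI : ¬ Function.Injective I) : besselMinor y t I = 0 := by
  simp only [Function.Injective, not_forall] at hI
  obtain ⟨a, b, hab, hne⟩ := hI
  refine Matrix.det_zero_of_row_eq hne ?_
  funext s
  simp [hab]

theorem besselMinor_eq_zero_of_neg {ℓ : ℕ} {y : Fin ℓ → ℤ} (hy : ∀ s, 0 ≤ y s) (t : ℝ)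
    {I : Fin ℓ → ℤ} {r : Fin ℓ} (hr : I r < 0) : besselMinor y t I = 0 := by
  refine Matrix.det_eq_zero_of_row_eq_zero r fun s => ?_
  have := hy s
  exact besselCoeff_of_neg _ (by omega)

/-- Thus every minor in the expansion has strictly increasing rows or has a repeated row and
vanishes. -/
theorem monotone_move {ℓ : ℕ} {I : Fin ℓ → ℤ} (hI : StrictMono I) (s : Finset (Fin ℓ)) :
    Monotone (fun r => if r ∈ s then I r else I r - 1) := by
  intro a b hab
  rcases hab.eq_or_lt with rfl | h
  · exact le_rfl
  · have := hI h
    dsimp only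
    split_ifs <;> omega

theorem neg_le_besselMinor_step {ℓ : ℕ} {y : Fin ℓ → ℤ} {t ε : ℝ} (ht : 0 < t) (hε : 0 ≤ ε) {M : ℤ}
    (h : ∀ I : Fin ℓ → ℤ, StrictMono I → (∀ r, I r ≤ M) →
      -(ε * Real.exp (ℓ * (1 / (t + 1)))) ≤ besselMinor y (t + 1) I)
    {I : Fin ℓ → ℤ} (hI : StrictMono I) (hM : ∀ r, I r ≤ M) :
    -(ε * Real.exp (ℓ * (1 / t))) ≤ besselMinor y t I := by
  set δ := ε * Real.exp (ℓ * (1 / (t + 1))) with hδ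
  have hδ0 : 0 ≤ δ := by positivity
  have key : ∀ s : Finset (Fin ℓ),
      -δ ≤ besselMinor y (t + 1) (fun r => if r ∈ s then I r else I r - 1) := by
    intro s
    by_cases hinj : Function.Injective (fun r => if r ∈ s then I r else I r - 1)
    · refine h _ ((monotone_move hI s).strictMono_of_injective hinj) fun r => ?_
      have := hM r
      split_ifs <;> omega
    · rw [besselMinor_eq_zero_of_not_injective _ _ hinj]
      linarith
  rw [besselMinor_expand y ht I]
  calc -(ε * Real.exp (ℓ * (1 / t)))
      = Real.exp (ℓ * (1 / t - 1 / (t + 1))) * (-δ) := by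
        rw [hδ, show (ℓ : ℝ) * (1 / t) = ℓ * (1 / t - 1 / (t + 1)) + ℓ * (1 / (t + 1)) by ring,
          Real.exp_add]
        ring
    _ ≤ (∑ s : Finset (Fin ℓ), ∏ r, if r ∈ s then stayWeight (I r) else moveWeight t (I r)) *
          (-δ) := mul_le_mul_of_nonpos_right (sum_prod_weight_le ht I) (by linarith)
    _ ≤ _ := by
        rw [Finset.sum_mul]
        exact Finset.sum_le_sum fun s _ =>
          mul_le_mul_of_nonneg_left (key s) (prod_weight_nonneg ht I s)

theorem neg_le_besselMinor {ℓ : ℕ} {y : Fin ℓ → ℤ} {ε : ℝ} (hε : 0 ≤ ε) {M : ℤ} (N : ℕ) :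
    ∀ t : ℝ, 0 < t → (∀ I : Fin ℓ → ℤ, StrictMono I → (∀ r, I r ≤ M) →
      -ε ≤ besselMinor y (t + N) I) →
    ∀ I : Fin ℓ → ℤ, StrictMono I → (∀ r, I r ≤ M) →
      -(ε * Real.exp (ℓ * (1 / t))) ≤ besselMinor y t I := by
  induction N with
  | zero =>
    intro t ht h I hI hM
    have h1 := h I hI hM
    rw [Nat.cast_zero, add_zero] at h1
    refine le_trans (neg_le_neg (le_mul_of_one_le_right hε (Real.one_le_exp ?_))) h1
    positivity
  | succ N ih =>
    intro t ht h I hI hM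
    refine neg_le_besselMinor_step ht hε (ih (t + 1) (by positivity) ?_) hI hM
    rwa [show t + 1 + (N : ℝ) = t + ((N + 1 : ℕ) : ℝ) by push_cast; ring]

/-! ### The limit of large parameter and nonnegativity -/

open Filter Topology in
theorem tendsto_besselCoeff (n : ℤ) :
    Tendsto (fun t => besselCoeff t n) atTop (𝓝 (if n = 0 then 1 else 0)) := by
  rcases lt_trichotomy n 0 with hn | rfl | hn
  · simp [besselCoeff_of_neg _ hn, hn.ne]
  · simp [besselCoeff_zero]
  · obtain ⟨k, rfl⟩ : ∃ k : ℕ, n = ((k + 1 : ℕ) : ℤ) := ⟨(n - 1).toNat, by omega⟩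
    rw [if_neg (by omega)]
    have h1 : ∀ t : ℝ, 1 ≤ t → ∀ j : ℕ, 1 ≤ (ascPochhammer ℝ j).eval t := by
      intro t ht j
      induction j with
      | zero => simp
      | succ j ih =>
        rw [ascPochhammer_succ_eval]
        exact one_le_mul_of_one_le_of_one_le ih (by linarith [(Nat.cast_nonneg j : (0 : ℝ) ≤ j)])
    refine tendsto_of_tendsto_of_tendsto_of_le_of_le' tendsto_const_nhds
      tendsto_inv_atTop_zero ?_ ?_
    · filter_upwards [eventually_ge_atTop 1] with t ht
      rw [besselCoeff_natCast]
      have := h1 t ht (k + 1)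
      positivity
    · filter_upwards [eventually_ge_atTop 1] with t ht
      rw [besselCoeff_natCast, inv_eq_one_div]
      refine one_div_le_one_div_of_le (by linarith) ?_
      rw [ascPochhammer_eval_succ_left, mul_assoc]
      refine le_mul_of_one_le_right (by linarith) ?_
      refine one_le_mul_of_one_le_of_one_le (h1 _ (by linarith) _) ?_
      exact_mod_cast Nat.one_le_iff_ne_zero.mpr (Nat.factorial_ne_zero _)

/-- The matrix is the identity, or has a zero row, or has two equal rows. -/
theorem det_indicator_nonneg {ℓ : ℕ} {x y : Fin ℓ → ℤ} (hx : Monotone x) (hy : StrictMono y) :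
    0 ≤ Matrix.det (Matrix.of fun r s => if x r - y s = 0 then (1 : ℝ) else 0) := by
  by_cases hinj : Function.Injective x
  · have hx' := hx.strictMono_of_injective hinj
    by_cases hsub : Set.range x ⊆ Set.range y
    · choose f hf using fun r => hsub ⟨r, rfl⟩
      have hmono : StrictMono f := fun a b hab => hy.lt_iff_lt.mp (by rw [hf, hf]; exact hx' hab)
      -- The only strictly increasing self-map of `Fin ℓ` is the identity.
      have hxy : ∀ r, x r = y r := fun r => by
        have : f = id := by
          have := Subsingleton.elim (hmono.orderIsoOfSurjective f
            (Finite.surjective_of_injective hmono.injective)) (OrderIso.refl _)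
          funext a
          exact DFunLike.congr_fun this a
        rw [← hf r, this, id]
      have h1 : (Matrix.of fun r s => if x r - y s = 0 then (1 : ℝ) else 0) = 1 := by
        ext r s
        simp [Matrix.one_apply, hxy, sub_eq_zero, hy.injective.eq_iff]
      rw [h1, Matrix.det_one]
      exact zero_le_one
    · obtain ⟨_, ⟨r, rfl⟩, hr⟩ := Set.not_subset.mp hsub
      refine (Matrix.det_eq_zero_of_row_eq_zero r fun s => ?_).ge
      have : x r - y s ≠ 0 := fun h => hr ⟨s, by omega⟩
      simp [this]
  · simp only [Function.Injective, not_forall] at hinj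
    obtain ⟨a, b, hab, hne⟩ := hinj
    refine (Matrix.det_zero_of_row_eq hne ?_).ge
    funext s
    simp [hab]

open Filter Topology in
theorem tendsto_besselMinor {ℓ : ℕ} (y I : Fin ℓ → ℤ) :
    Tendsto (fun t => besselMinor y t I) atTop
      (𝓝 (Matrix.det (Matrix.of fun r s => if I r / 2 - y s = 0 then (1 : ℝ) else 0))) := by
  have hc : Continuous (fun A : Matrix (Fin ℓ) (Fin ℓ) ℝ => A.det) := continuous_id.matrix_det
  refine (hc.tendsto _).comp ?_
  refine tendsto_pi_nhds.mpr fun r => tendsto_pi_nhds.mpr fun s => ?_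
  by_cases h : Even (I r)
  · simpa [besselRow, h] using tendsto_besselCoeff (I r / 2 - y s)
  · simpa [besselRow, h, Function.comp_def] using
      (tendsto_besselCoeff (I r / 2 - y s)).comp (tendsto_atTop_add_const_right _ 1 tendsto_id)

open Filter in
theorem besselMinor_nonneg {ℓ : ℕ} {y : Fin ℓ → ℤ} (hy : StrictMono y) (hy0 : ∀ s, 0 ≤ y s)
    {t : ℝ} (ht : 0 < t) {I : Fin ℓ → ℤ} (hI : StrictMono I) : 0 ≤ besselMinor y t I := by
  obtain ⟨M, hM⟩ : ∃ M, ∀ r, I r ≤ M := by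
    obtain ⟨M, hM⟩ := (Set.finite_range I).bddAbove
    exact ⟨M, fun r => hM ⟨r, rfl⟩⟩
  have hev : ∀ ε : ℝ, 0 < ε → ∃ N : ℕ, ∀ K : Fin ℓ → ℤ, StrictMono K → (∀ r, K r ≤ M) →
      -ε ≤ besselMinor y (t + N) K := by
    intro ε hε
    -- Convergence must be uniform over the row sets. Rows never move up, so they stay below `M`,
    -- and a negative row kills the minor: finitely many row sets matter.
    have hfin : Set.Finite {K : Fin ℓ → ℤ | StrictMono K ∧ ∀ r, K r ∈ Set.Icc 0 M} :=
      (Set.Finite.pi' fun _ => Set.finite_Icc 0 M).subset fun K hK => hK.2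
    have hlim : Tendsto (fun N : ℕ => t + (N : ℝ)) atTop atTop :=
      tendsto_atTop_add_const_left _ _ tendsto_natCast_atTop_atTop
    have h1 : ∀ᶠ u in atTop, ∀ K ∈ {K : Fin ℓ → ℤ | StrictMono K ∧ ∀ r, K r ∈ Set.Icc 0 M},
        -ε ≤ besselMinor y u K := by
      refine (eventually_all_finite hfin).mpr fun K hK => ?_
      have hnn := det_indicator_nonneg (x := fun r => K r / 2) (fun a b hab =>
        Int.ediv_le_ediv (by norm_num) (hK.1.monotone hab)) hy
      filter_upwards [(tendsto_besselMinor y K).eventually (lt_mem_nhds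
        (show -ε < _ from lt_of_lt_of_le (by linarith) hnn))] with u hu
      exact hu.le
    obtain ⟨N, hN⟩ := (hlim.eventually h1).exists
    refine ⟨N, fun K hK hKM => ?_⟩
    by_cases hneg : ∃ r, K r < 0
    · obtain ⟨r, hr⟩ := hneg
      rw [besselMinor_eq_zero_of_neg hy0 _ hr]
      linarith
    · push Not at hneg
      exact hN K ⟨hK, fun r => ⟨hneg r, hKM r⟩⟩
  by_contra! hlt
  have hE := Real.exp_pos ((ℓ : ℝ) * (1 / t))
  -- This tolerance, multiplied by `exp (ℓ / t)`, is half of the supposed negative value's size.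
  obtain ⟨N, hN⟩ := hev (-besselMinor y t I / 2 / Real.exp (ℓ * (1 / t)))
    (div_pos (by linarith) hE)
  have h2 := neg_le_besselMinor (div_nonneg (by linarith) hE.le) N t ht hN I hI hM
  rw [div_mul_cancel₀ _ hE.ne'] at h2
  linarith

/-! ### Strict positivity -/

/-- A minor dominates each single term of its expansion. -/
theorem le_besselMinor {ℓ : ℕ} {y : Fin ℓ → ℤ} (hy : StrictMono y) (hy0 : ∀ s, 0 ≤ y s)
    {t : ℝ} (ht : 0 < t) {I : Fin ℓ → ℤ} (hI : StrictMono I) (s : Finset (Fin ℓ)) :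
    (∏ r, if r ∈ s then stayWeight (I r) else moveWeight t (I r)) *
      besselMinor y (t + 1) (fun r => if r ∈ s then I r else I r - 1) ≤ besselMinor y t I := by
  rw [besselMinor_expand y ht I]
  refine Finset.single_le_sum (f := fun s : Finset (Fin ℓ) =>
    (∏ r, if r ∈ s then stayWeight (I r) else moveWeight t (I r)) *
      besselMinor y (t + 1) (fun r => if r ∈ s then I r else I r - 1))
    (fun s _ => mul_nonneg (prod_weight_nonneg ht I s) ?_) (Finset.mem_univ s)
  by_cases hinj : Function.Injective (fun r => if r ∈ s then I r else I r - 1)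
  · exact besselMinor_nonneg hy hy0 (by positivity)
      ((monotone_move hI s).strictMono_of_injective hinj)
  · rw [besselMinor_eq_zero_of_not_injective _ _ hinj]

/-- The term lowering only row `r` has positive weight: a move always does, but staying does only on
even rows. -/
theorem besselMinor_pos_of_move {ℓ : ℕ} {y : Fin ℓ → ℤ} (hy : StrictMono y) (hy0 : ∀ s, 0 ≤ y s)
    {t : ℝ} (ht : 0 < t) {I : Fin ℓ → ℤ} (hI : StrictMono I) (r : Fin ℓ)
    (heven : ∀ q, q ≠ r → Even (I q))
    (hpos : 0 < besselMinor y (t + 1) (Function.update I r (I r - 1))) :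
    0 < besselMinor y t I := by
  have h := le_besselMinor hy hy0 ht hI (Finset.univ.erase r)
  have h1 : (fun q => if q ∈ Finset.univ.erase r then I q else I q - 1) =
      Function.update I r (I r - 1) := by
    funext q
    by_cases hq : q = r
    · subst hq; simp
    · simp [hq]
  rw [h1] at h
  refine lt_of_lt_of_le (mul_pos (Finset.prod_pos fun q _ => ?_) hpos) h
  by_cases hq : q = r
  · subst hq
    simp only [Finset.mem_erase, ne_eq, not_true_eq_false, false_and, if_false, moveWeight]
    split_ifs <;> positivity
  · simp [hq, stayWeight, heven q hq]

theorem besselMinor_two_mul_self {ℓ : ℕ} {y : Fin ℓ → ℤ} (hy : StrictMono y) (t : ℝ) :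
    besselMinor y t (fun r => 2 * y r) = 1 := by
  unfold besselMinor
  rw [Matrix.det_of_isLowerTriangular]
  · refine Finset.prod_eq_one fun r _ => ?_
    simp [besselRow, besselCoeff_zero]
  · intro r s hrs
    have : y r < y s := hy hrs
    exact besselCoeff_of_neg _ (by dsimp only; omega)

theorem besselMinor_two_mul_pos {ℓ : ℕ} {y : Fin ℓ → ℤ} (hy : StrictMono y) (hy0 : ∀ s, 0 ≤ y s)
    (d : ℕ) : ∀ (t : ℝ), 0 < t → ∀ x : Fin ℓ → ℤ, StrictMono x → (∀ r, y r ≤ x r) →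
      ∑ r, (x r - y r) = d → 0 < besselMinor y t (fun r => 2 * x r) := by
  induction d with
  | zero =>
    intro t ht x hx hyx hd
    have h0 := (Finset.sum_eq_zero_iff_of_nonneg fun r _ => sub_nonneg.mpr (hyx r)).mp
      (by simpa using hd)
    obtain rfl : x = y := funext fun r => by have := h0 r (Finset.mem_univ r); omega
    rw [besselMinor_two_mul_self hy]
    exact one_pos
  | succ d ih =>
    intro t ht x hx hyx hd
    have hex : ∃ r, y r < x r := by
      by_contra! hle
      have : ∑ r, (x r - y r) ≤ 0 := Finset.sum_nonpos fun r _ => by linarith [hle r]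
      omega
    -- Below the least such `r` the rows already agree with `y`, so there is room to lower `x r` by
    -- one.
    obtain ⟨r, hr, hmin⟩ := WellFounded.has_min (wellFounded_lt (α := Fin ℓ))
      {r | y r < x r} hex
    have hr' : y r < x r := hr
    have hbelow : ∀ q, q < r → x q < x r - 1 := fun q hq => by
      have h1 : ¬ y q < x q := fun h => hmin q h hq
      have h2 := hy hq
      omega
    have hstrict : ∀ (I : Fin ℓ → ℤ) (v : ℤ), StrictMono I → v ≤ I r → (∀ q, q < r → I q < v) →
        StrictMono (Function.update I r v) := by
      intro I v hI hv hlow a b hab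
      by_cases ha : a = r
      · subst ha
        rw [Function.update_self, Function.update_of_ne hab.ne']
        exact hv.trans_lt (hI hab)
      · by_cases hb : b = r
        · subst hb
          rw [Function.update_self, Function.update_of_ne ha]
          exact hlow a hab
        · rw [Function.update_of_ne ha, Function.update_of_ne hb]
          exact hI hab
    have h2x : StrictMono (fun q => 2 * x q) := fun a b hab => by have := hx hab; dsimp only; omega
    have hx' : StrictMono (Function.update x r (x r - 1)) := hstrict x _ hx (by omega) hbelow
    -- Lowering `x r` by one takes two half-steps, `2 * x r` to `2 * x r - 1` to `2 * x r - 2`, and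
    -- raises the parameter by two.
    refine besselMinor_pos_of_move hy hy0 ht h2x r (fun q _ => even_two_mul _) ?_
    refine besselMinor_pos_of_move hy hy0 (by positivity)
      (hstrict _ _ h2x (by omega) fun q hq => by have := hbelow q hq; omega) r
      (fun q hq => by rw [Function.update_of_ne hq]; exact even_two_mul _) ?_
    have hup : Function.update (Function.update (fun q => 2 * x q) r (2 * x r - 1)) r
        (Function.update (fun q => 2 * x q) r (2 * x r - 1) r - 1) =
        fun q => 2 * Function.update x r (x r - 1) q := by
      funext q
      by_cases hq : q = r
      · subst hq
        simp only [Function.update_self]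
        ring
      · simp [hq]
    rw [hup]
    refine ih _ (by positivity) _ hx' (fun q => ?_) ?_
    · by_cases hq : q = r
      · subst hq
        rw [Function.update_self]
        omega
      · rw [Function.update_of_ne hq]
        exact hyx q
    · rw [← Finset.add_sum_erase _ _ (Finset.mem_univ r)] at hd ⊢
      rw [Function.update_self]
      have : ∑ q ∈ Finset.univ.erase r, (Function.update x r (x r - 1) q - y q) =
          ∑ q ∈ Finset.univ.erase r, (x q - y q) :=
        Finset.sum_congr rfl fun q hq => by rw [Function.update_of_ne (Finset.ne_of_mem_erase hq)]
      rw [this]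
      push_cast at hd
      linarith

/-- Strict total positivity of the Toeplitz matrix of the numbers `1 / ((t)_n n!)`. -/
theorem det_besselCoeff_pos {ℓ : ℕ} {x y : Fin ℓ → ℤ} (hx : StrictMono x) (hy : StrictMono y)
    (hy0 : ∀ s, 0 ≤ y s) (hyx : ∀ r, y r ≤ x r) {t : ℝ} (ht : 0 < t) :
    0 < Matrix.det (Matrix.of fun r s => besselCoeff t (x r - y s)) := by
  have h := besselMinor_two_mul_pos hy hy0 (∑ r, (x r - y r)).toNat t ht x hx hyx
    (Int.toNat_of_nonneg (Finset.sum_nonneg fun r _ => sub_nonneg.mpr (hyx r))).symm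
  have h1 : besselMinor y t (fun r => 2 * x r) =
      Matrix.det (Matrix.of fun r s => besselCoeff t (x r - y s)) := by
    unfold besselMinor
    congr 1
    ext r s
    simp [besselRow]
  rwa [h1] at h

/-! ### Passage to skew Schur functions -/

theorem map_completeSymmInt {t : ℝ} {φ : SymmFun →ₐ[ℝ] ℝ}
    (hφ : ∀ n : ℕ, φ (completeSymm n) = 1 / ((ascPochhammer ℝ n).eval t * (n.factorial : ℝ)))
    (k : ℤ) : φ (completeSymmInt k) = besselCoeff t k := by
  unfold completeSymmInt besselCoeff
  split_ifs
  exacts [hφ _, map_zero φ]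

theorem map_skewSchur_pos {t : ℝ} (ht : 0 < t) {φ : SymmFun →ₐ[ℝ] ℝ}
    (hφ : ∀ n : ℕ, φ (completeSymm n) = 1 / ((ascPochhammer ℝ n).eval t * (n.factorial : ℝ)))
    {ℓ : ℕ} {lam mu : Fin ℓ → ℕ} (hlam : Antitone lam) (hmu : Antitone mu)
    (hle : ∀ i, mu i ≤ lam i) : 0 < φ (skewSchur lam mu) := by
  have hstrict : ∀ {nu : Fin ℓ → ℕ}, Antitone nu →
      StrictMono (fun r : Fin ℓ => (nu r.rev : ℤ) + (r : ℤ)) := by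
    intro nu hnu a b hab
    have h1 : nu a.rev ≤ nu b.rev := hnu (Fin.rev_le_rev.mpr hab.le)
    have h2 : (a : ℕ) < b := hab
    dsimp only
    omega
  have h := det_besselCoeff_pos (hstrict hlam) (hstrict hmu) (fun s => by positivity)
    (fun r => by have := hle r.rev; omega) ht
  -- Reversing rows and columns together keeps the determinant and makes the sequences `λ_i - i` and
  -- `μ_j - j` increasing; their common shift by `ℓ - 1` cancels.
  rw [skewSchur, AlgHom.map_det, ← Matrix.det_submatrix_equiv_self Fin.revPerm]
  convert h using 2
  ext r s
  have hr := Fin.val_rev r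
  have hs := Fin.val_rev s
  simp only [AlgHom.mapMatrix_apply, Matrix.submatrix_apply, Matrix.map_apply, Matrix.of_apply,
    Fin.revPerm_apply, map_completeSymmInt hφ]
  congr 1
  omega

theorem theorem3p1 (t : ℝ) (ht : 0 < t) (φ : SymmFun →ₐ[ℝ] ℝ)
    (hφ : ∀ n : ℕ, φ (completeSymm n) = 1 / ((ascPochhammer ℝ n).eval t * (n.factorial : ℝ))) :
    (∀ (ℓ : ℕ) (lam mu : Fin ℓ → ℕ), Antitone lam → Antitone mu → (∀ i, mu i ≤ lam i) →
      0 < φ (skewSchur lam mu)) ∧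
    (∀ (ℓ : ℕ) (lam : Fin ℓ → ℕ), Antitone lam → 0 < φ (schur lam)) :=
  ⟨fun _ _ _ hlam hmu hle => map_skewSchur_pos ht hφ hlam hmu hle,
    fun _ _ hlam => map_skewSchur_pos ht hφ hlam antitone_const fun _ => Nat.zero_le _⟩
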